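/- Let $\mu>0$ and let $U,W:\mathbb{R}^d\to\mathbb{R}$ satisfy: (A) $U$ and $W$ are $-\Delta$-bounded with relative bound zero: for $X=U,W$, the domain $\{g\in L^2(\mathbb{R}^d): Xg\in L^2(\mathbb{R}^d)\}$ of multiplication by $X$ contains the Sobolev space $H^2(\mathbb{R}^d)=\mathcal{D}(-\Delta)$, and for every $\varepsilon>0$ there is a constant $C_\varepsilon$ with $\|Xg\|_2\le\varepsilon\|-\Delta g\|_2+C_\varepsilon\|g\|_2$ for all $g\in H^2(\mathbb{R}^d)$; (B) $U(x)\to0$ and $W(x)\to0$ as $|x|\to\infty$ (up to null sets; no rate is assumed). On $L^2(\mathbb{R}^d,\mathbb{C}^2)$ consider the operator $$\mathcal{H}=\begin{pmatrix}-\Delta+\mu+U & W\\ -W & \Delta-\mu-U\end{pmatrix},\qquad \mathcal{D}(\mathcal{H})=H^2(\mathbb{R}^d,\mathbb{C}^2).$$ Let $E\in\mathbb{C}$ be an eigenvalue of $\mathcal{H}$ with $-\mu<\operatorname{Re}E<\mu$. Then every eigenfunction and generalized eigenfunction of $\mathcal{H}$ for $E$ decays exponentially; precisely, if $k\in\mathbb{N}$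 and $\varphi$ in the natural domain of $(\mathcal{H}-E)^k$ satisfies $(\mathcal{H}-E)^k\varphi=0$, then $$e^{\sqrt{\mu-|\operatorname{Re}E|-2\delta}\,|x|}\,\varphi\in L^2(\mathbb{R}^d,\mathbb{C}^2)\qquad\text{for all } 0<\delta<\tfrac12\bigl(\mu-|\operatorname{Re}E|\bigr).$$ -/

import Mathlib

namespace MatrixSchrodinger

open MeasureTheory Filter Topology TemperedDistribution
open scoped SchwartzMap Laplacian

noncomputable section

/-- Euclidean space `ℝ^d`. -/
abbrev Rd (d : ℕ) : Type := EuclideanSpace ℝ (Fin d)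

/-- `ℂ²` with its Euclidean norm. -/
abbrev C2 : Type := EuclideanSpace ℂ (Fin 2)

/-- `L²(ℝ^d) = L²(ℝ^d, ℂ)`. -/
abbrev L2 (d : ℕ) : Type := Lp ℂ 2 (volume : Measure (Rd d))

/-- `L²(ℝ^d, ℂ²)`. -/
abbrev L2C2 (d : ℕ) : Type := Lp C2 2 (volume : Measure (Rd d))

/-! ### Unbounded operators -/

/-- The product `g f` of two unbounded operators on its natural domain
`{x ∈ D(f) | f x ∈ D(g)}`. -/
def opComp {H : Type*} [AddCommGroup H] [Module ℂ H] (g f : H →ₗ.[ℂ] H) : H →ₗ.[ℂ] H :=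
  g.comp (f.domRestrict ((g.domain.comap f.toFun).map f.domain.subtype)) (by
    rintro ⟨x, hx⟩
    obtain ⟨⟨y, hy, rfl⟩, -⟩ := id hx
    exact hy)

/-- The powers `T^k` of an unbounded operator on their natural domains:
`T^0 = 1` and `D(T^(k+1)) = {x ∈ D(T) | T x ∈ D(T^k)}`. -/
def opPow {H : Type*} [AddCommGroup H] [Module ℂ H] (T : H →ₗ.[ℂ] H) : ℕ → H →ₗ.[ℂ] H
  | 0 => LinearMap.id.toPMap ⊤
  | k + 1 => opComp (opPow T k) T

/-- The scalar operator `c · 1`, defined everywhere. -/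
def scalarOp (H : Type*) [AddCommGroup H] [Module ℂ H] (c : ℂ) : H →ₗ.[ℂ] H :=
  (c • (LinearMap.id : H →ₗ[ℂ] H)).toPMap ⊤

/-- `E` is an eigenvalue of the unbounded operator `T`. -/
def IsEigenvalue {H : Type*} [AddCommGroup H] [Module ℂ H] (T : H →ₗ.[ℂ] H) (E : ℂ) : Prop :=
  ∃ ψ : T.domain, (ψ : H) ≠ 0 ∧ T ψ = E • (ψ : H)

/-! ### The Laplacian on `H²(ℝ^d)` -/

/-- The Sobolev space `H²(ℝ^d)`, as a subspace of `L²(ℝ^d)`. -/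
def sobolevH2 (d : ℕ) : Submodule ℂ (L2 d) where
  carrier := {g | MemSobolev 2 2 (g : 𝓢'(Rd d, ℂ))}
  zero_mem' := by
    have := memSobolev_fun_zero (Rd d) ℂ 2 2
    rwa [← map_zero (Lp.toTemperedDistributionCLM ℂ (volume : Measure (Rd d)) 2)] at this
  add_mem' {f g} hf hg := by
    have := MemSobolev.add hf hg
    rwa [← Lp.toTemperedDistributionCLM_apply, ← Lp.toTemperedDistributionCLM_apply g,
      ← map_add] at this
  smul_mem' c f hf := by
    have := MemSobolev.smul c hf
    rwa [← Lp.toTemperedDistributionCLM_apply, ← map_smul] at this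

theorem toTemperedDistribution_injective (d : ℕ) {f g : L2 d}
    (h : (f : 𝓢'(Rd d, ℂ)) = (g : 𝓢'(Rd d, ℂ))) : f = g :=
  LinearMap.ker_eq_bot.mp
    (Lp.ker_toTemperedDistributionCLM_eq_bot (F := ℂ) (p := 2) (μ := (volume : Measure (Rd d)))) h

/-- The distributional Laplacian of an `H²` function is (represented by) an `L²` function. -/
theorem exists_laplacian {d : ℕ} (g : sobolevH2 d) :
    ∃ h : L2 d, (h : 𝓢'(Rd d, ℂ)) = Δ ((g : L2 d) : 𝓢'(Rd d, ℂ)) := by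
  have h : MemSobolev 2 2 ((g : L2 d) : 𝓢'(Rd d, ℂ)) := g.2
  have := h.laplacian
  rw [sub_self, memSobolev_zero_iff] at this
  obtain ⟨h, hh⟩ := this
  exact ⟨h, hh.symm⟩

/-- The Laplacian `Δ` in `L²(ℝ^d)` with domain `H²(ℝ^d)`: `Δ g` is the `L²` function that
represents the distributional Laplacian of `g`. -/
def laplacianOp (d : ℕ) : L2 d →ₗ.[ℂ] L2 d where
  domain := sobolevH2 d
  toFun :=
    { toFun := fun g => (exists_laplacian g).choose
      map_add' := fun f g => by
        apply toTemperedDistribution_injective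
        have hf := (exists_laplacian f).choose_spec
        have hg := (exists_laplacian g).choose_spec
        rw [(exists_laplacian (f + g)).choose_spec]
        simp only [← Lp.toTemperedDistributionCLM_apply, ← laplacianCLM_apply] at hf hg ⊢
        rw [map_add, hf, hg, Submodule.coe_add, map_add, map_add]
      map_smul' := fun c f => by
        apply toTemperedDistribution_injective
        have hf := (exists_laplacian f).choose_spec
        rw [(exists_laplacian (c • f)).choose_spec]
        simp only [← Lp.toTemperedDistributionCLM_apply, ← laplacianCLM_apply] at hf ⊢
        rw [RingHom.id_apply, map_smul, hf, Submodule.coe_smul, map_smul, map_smul] }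

/-! ### Multiplication operators -/

theorem mul_add_ae {d : ℕ} (X : Rd d → ℝ) (f g : L2 d) :
    (fun x => (X x : ℂ) * (f + g : L2 d) x) =ᵐ[volume]
      (fun x => (X x : ℂ) * f x) + fun x => (X x : ℂ) * g x := by
  filter_upwards [Lp.coeFn_add f g] with x hx
  rw [hx, Pi.add_apply, Pi.add_apply, mul_add]

theorem mul_smul_ae {d : ℕ} (X : Rd d → ℝ) (c : ℂ) (f : L2 d) :
    (fun x => (X x : ℂ) * (c • f : L2 d) x) =ᵐ[volume] c • fun x => (X x : ℂ) * f x := by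
  filter_upwards [Lp.coeFn_smul c f] with x hx
  rw [hx, Pi.smul_apply, Pi.smul_apply, smul_eq_mul, smul_eq_mul, mul_left_comm]

/-- The maximal domain `{g ∈ L² | X g ∈ L²}` of multiplication by `X` in `L²(ℝ^d)`. -/
def mulDomain {d : ℕ} (X : Rd d → ℝ) : Submodule ℂ (L2 d) where
  carrier := {g | MemLp (fun x => (X x : ℂ) * g x) 2 volume}
  zero_mem' := by
    refine (memLp_congr_ae ?_).mpr (MemLp.zero (ε := ℂ))
    filter_upwards [Lp.coeFn_zero ℂ 2 (volume : Measure (Rd d))] with x hx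
    rw [hx, Pi.zero_apply, mul_zero]
  add_mem' {f g} hf hg := (memLp_congr_ae (mul_add_ae X f g)).mpr (MemLp.add hf hg)
  smul_mem' c f hf := (memLp_congr_ae (mul_smul_ae X c f)).mpr (MemLp.const_smul hf c)

theorem mem_mulDomain {d : ℕ} {X : Rd d → ℝ} {g : L2 d} :
    g ∈ mulDomain X ↔ MemLp (fun x => (X x : ℂ) * g x) 2 volume :=
  Iff.rfl

/-- The product `X g` as an element of `L²(ℝ^d)`. -/
def mulFun {d : ℕ} (X : Rd d → ℝ) (g : mulDomain X) : L2 d :=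
  MemLp.toLp (fun x => (X x : ℂ) * (g : L2 d) x) (mem_mulDomain.mp g.2)

theorem coeFn_mulFun {d : ℕ} (X : Rd d → ℝ) (g : mulDomain X) :
    mulFun X g =ᵐ[volume] fun x => (X x : ℂ) * (g : L2 d) x :=
  MemLp.coeFn_toLp _

theorem mulFun_add {d : ℕ} (X : Rd d → ℝ) (f g : mulDomain X) :
    mulFun X (f + g) = mulFun X f + mulFun X g := by
  apply Lp.ext
  filter_upwards [coeFn_mulFun X (f + g), coeFn_mulFun X f, coeFn_mulFun X g,
    Lp.coeFn_add (mulFun X f) (mulFun X g), mul_add_ae X f g] with x h₁ h₂ h₃ h₄ h₅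
  rw [h₁, h₄, Pi.add_apply, h₂, h₃]
  exact h₅

theorem mulFun_smul {d : ℕ} (X : Rd d → ℝ) (c : ℂ) (f : mulDomain X) :
    mulFun X (c • f) = c • mulFun X f := by
  apply Lp.ext
  filter_upwards [coeFn_mulFun X (c • f), coeFn_mulFun X f,
    Lp.coeFn_smul c (mulFun X f), mul_smul_ae X c f] with x h₁ h₂ h₃ h₄
  rw [h₁, h₃, Pi.smul_apply, h₂]
  exact h₄

/-- The multiplication operator `g ↦ X g` in `L²(ℝ^d)` with its maximal domain. -/
def mulOp {d : ℕ} (X : Rd d → ℝ) : L2 d →ₗ.[ℂ] L2 d where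
  domain := mulDomain X
  toFun :=
    { toFun := mulFun X
      map_add' := mulFun_add X
      map_smul' := mulFun_smul X }

/-- `X` is `-Δ`-bounded with relative bound zero. -/
def IsLaplacianBoundedWithBoundZero {d : ℕ} (X : Rd d → ℝ) : Prop :=
  ∃ h : (laplacianOp d).domain ≤ (mulOp X).domain,
    ∀ ε : ℝ, 0 < ε → ∃ C : ℝ, ∀ g : (laplacianOp d).domain,
      ‖mulOp X ⟨g, h g.2⟩‖ ≤ ε * ‖(-laplacianOp d) g‖ + C * ‖(g : L2 d)‖

/-- `X(x) → 0` as `|x| → ∞`, up to a Lebesgue null set. -/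
def TendsToZeroAtInfinity {d : ℕ} (X : Rd d → ℝ) : Prop :=
  Tendsto X (cocompact (Rd d) ⊓ ae volume) (𝓝 0)

/-! ### The matrix operator -/

/-- The `j`-th component of an element of `L²(ℝ^d, ℂ²)`. -/
def component {d : ℕ} (j : Fin 2) : L2C2 d →L[ℂ] L2 d :=
  (EuclideanSpace.proj j : C2 →L[ℂ] ℂ).compLpL 2 volume

/-- The element of `L²(ℝ^d, ℂ²)` with the given function as `i`-th component and `0` as the
other one. -/
def inclusion {d : ℕ} (i : Fin 2) : L2 d →L[ℂ] L2C2 d :=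
  (ContinuousLinearMap.toSpanSingleton ℂ (EuclideanSpace.single i (1 : ℂ) : C2)).compLpL 2 volume

/-- The operator in `L²(ℝ^d, ℂ²)` given by a `2 × 2` matrix of operators in `L²(ℝ^d)`,
`(A φ)_i = ∑_j A_{ij} φ_j`, on the domain `{φ | φ_j ∈ D(A_{ij}) for all i, j}`. -/
def matrixOp {d : ℕ} (A : Fin 2 → Fin 2 → (L2 d →ₗ.[ℂ] L2 d)) : L2C2 d →ₗ.[ℂ] L2C2 d where
  domain := ⨅ i, ⨅ j, (A i j).domain.comap (component j).toLinearMap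
  toFun :=
    { toFun := fun φ => ∑ i, inclusion i (∑ j, A i j ⟨component j (φ : L2C2 d), by
        have := φ.2
        simp only [Submodule.mem_iInf] at this
        exact this i j⟩)
      map_add' := fun φ ψ => by
        simp only [← Finset.sum_add_distrib, ← map_add]
        congr! 4 with i _ j _
        rw [← LinearPMap.map_add]
        congr 1
        ext1
        simp
      map_smul' := fun c φ => by
        simp only [Finset.smul_sum, ← map_smul, RingHom.id_apply]
        congr! 4 with i _ j _
        rw [← LinearPMap.map_smul]
        congr 1
        ext1
        simp }

/-- The system
`ℋ = (-Δ + μ + U, W; -W, Δ - μ - U)` in `L²(ℝ^d, ℂ²)`. All sums carry their natural domains; when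
`H²(ℝ^d) ⊆ D(U) ∩ D(W)`, the domain of `ℋ` is `H²(ℝ^d, ℂ²)`
(see `mem_systemOp_domain`). -/
def systemOp {d : ℕ} (μ : ℝ) (U W : Rd d → ℝ) : L2C2 d →ₗ.[ℂ] L2C2 d :=
  matrixOp
    ![![-laplacianOp d + scalarOp (L2 d) μ + mulOp U, mulOp W],
      ![-mulOp W, laplacianOp d - scalarOp (L2 d) μ - mulOp U]]

theorem mem_systemOp_domain {d : ℕ} (μ : ℝ) {U W : Rd d → ℝ}
    (hU : IsLaplacianBoundedWithBoundZero U) (hW : IsLaplacianBoundedWithBoundZero W)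
    (φ : L2C2 d) :
    φ ∈ (systemOp μ U W).domain ↔
      component 0 φ ∈ sobolevH2 d ∧ component 1 φ ∈ sobolevH2 d := by
  obtain ⟨hU, -⟩ := hU
  obtain ⟨hW, -⟩ := hW
  have key : ∀ j, component j φ ∈ (laplacianOp d).domain ↔ component j φ ∈ sobolevH2 d :=
    fun _ => Iff.rfl
  simp only [systemOp, matrixOp, Submodule.mem_iInf, Fin.forall_fin_two, Submodule.mem_comap,
    Matrix.cons_val_zero, Matrix.cons_val_one, LinearPMap.add_domain, LinearPMap.sub_domain,
    LinearPMap.neg_domain, Submodule.mem_inf, scalarOp, LinearMap.toPMap_domain,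
    Submodule.mem_top, and_true, ← key, ContinuousLinearMap.coe_coe]
  constructor
  · rintro ⟨⟨⟨h0, _⟩, _⟩, _, h1, _⟩
    exact ⟨h0, h1⟩
  · rintro ⟨h0, h1⟩
    exact ⟨⟨⟨h0, hU h0⟩, hW h1⟩, hW h0, h1, hU h1⟩

end

end MatrixSchrodinger

/-
Agmon's method. Let `χ` be a bounded positive weight with `|∇χ| ≤ a χ`. Integrating by parts and
completing the square gives `⟨χ² u, (a² - Δ) u⟩ ≥ 0` for the real inner product, for every `u` in
`H²`. The rows of `ℋ φ = E φ + ψ` express `Δ φ_j` through `φ` and `ψ`; where `|U| + |W| ≤ η` with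
`a² + |Re E| + η < μ`, they give `∑_j Re (conj φ_j · (a² φ_j - Δ φ_j)) ≤ K |ψ|² - c |φ|²` with
`c > 0`. Hence `∫ χ² |φ|²` is controlled by `∫ χ² |ψ|²` and a contribution from a fixed ball.
Letting the bounded weights increase to `exp (a⟨x⟩)` shows that `φ` decays at rate `a` as soon as
`ψ = (ℋ - E) φ` does, and generalized eigenfunctions follow by induction on the order.
-/

namespace MatrixSchrodinger

open MeasureTheory Filter Topology TemperedDistribution
open scoped SchwartzMap Laplacian LineDeriv FourierTransform

noncomputable section

section Sobolev

variable {V F : Type*} [NormedAddCommGroup V] [InnerProductSpace ℝ V] [FiniteDimensional ℝ V]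
  [MeasurableSpace V] [BorelSpace V] [NormedAddCommGroup F]

theorem laplacian_eq_smul_sub_besselPotential [NormedSpace ℂ F] (f : 𝓢'(V, F)) :
    Δ f = (2 * Real.pi) ^ 2 • (f - besselPotential V F 2 f) := by
  have hsymbol : (fun ξ : V => (((1 + ‖ξ‖ ^ 2) ^ (2 / 2 : ℝ) : ℝ) : ℂ)) =
      (fun _ => 1) + fun ξ => Complex.ofReal (‖ξ‖ ^ 2) := by
    ext; simp
  have hB : besselPotential V F 2 f = f + fourierMultiplierCLM F
      (fun ξ : V => Complex.ofReal (‖ξ‖ ^ 2)) f := by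
    simp only [besselPotential, hsymbol, fourierMultiplierCLM_apply]
    rw [smulLeftCLM_add (by fun_prop) (by fun_prop)]
    simp
  rw [laplacian_eq_fourierMultiplierCLM, hB, sub_add_cancel_left, smul_neg, neg_smul]

variable [InnerProductSpace ℂ F] [CompleteSpace F]

theorem eq_of_toTemperedDistribution_eq {f g : Lp F 2 (volume : Measure V)}
    (h : (f : 𝓢'(V, F)) = (g : 𝓢'(V, F))) : f = g :=
  LinearMap.ker_eq_bot.mp
    (Lp.ker_toTemperedDistributionCLM_eq_bot (F := F) (p := 2) (μ := (volume : Measure V))) h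

theorem exists_clm_coe_eq_fourierMultiplierCLM {m : V → ℂ} (hm : m.HasTemperateGrowth) {C : ℝ}
    (hC : ∀ ξ, ‖m ξ‖ ≤ C) :
    ∃ T : Lp F 2 (volume : Measure V) →L[ℂ] Lp F 2 (volume : Measure V),
      ∀ f, (T f : 𝓢'(V, F)) = fourierMultiplierCLM F m (f : 𝓢'(V, F)) := by
  have hmem : MemLp m ⊤ (volume : Measure V) :=
    memLp_top_of_bound hm.1.continuous.aestronglyMeasurable C (ae_of_all _ hC)
  let 𝓕L2 := (Lp.fourierTransformₗᵢ V F).toContinuousLinearEquiv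
  let M : Lp F 2 (volume : Measure V) →L[ℂ] Lp F 2 (volume : Measure V) :=
    (ContinuousLinearMap.lsmul ℂ ℂ).holderL volume ⊤ 2 2 (hmem.toLp m)
  refine ⟨𝓕L2.symm.toContinuousLinearMap ∘L M ∘L 𝓕L2.toContinuousLinearMap, fun f => ?_⟩
  change ((𝓕⁻ (hmem.toLp m • 𝓕 f) : Lp F 2 (volume : Measure V)) : 𝓢'(V, F)) = _
  rw [← Lp.fourierInv_toTemperedDistribution_eq, Lp.toTemperedDistribution_smul_eq hm,
    ← Lp.fourier_toTemperedDistribution_eq, fourierMultiplierCLM_apply]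

theorem exists_clm_coe_eq_besselPotential {s : ℝ} (hs : s ≤ 0) :
    ∃ T : Lp F 2 (volume : Measure V) →L[ℂ] Lp F 2 (volume : Measure V),
      ∀ f, (T f : 𝓢'(V, F)) = besselPotential V F s (f : 𝓢'(V, F)) := by
  refine exists_clm_coe_eq_fourierMultiplierCLM (C := 1) (by fun_prop) fun ξ => ?_
  rw [Complex.norm_real, Real.norm_of_nonneg (by positivity)]
  exact Real.rpow_le_one_of_one_le_of_nonpos (by simp) (by linarith)

theorem exists_toLp_eq_of_coe_eq_besselPotential {s : ℝ}
    {T : Lp F 2 (volume : Measure V) →L[ℂ] Lp F 2 (volume : Measure V)}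
    (hT : ∀ f, (T f : 𝓢'(V, F)) = besselPotential V F s (f : 𝓢'(V, F))) (v : 𝓢(V, F)) :
    ∃ w : 𝓢(V, F), T (v.toLp 2) = w.toLp 2 := by
  refine ⟨SchwartzMap.fourierMultiplierCLM F
    (fun ξ : V => (((1 + ‖ξ‖ ^ 2) ^ (s / 2) : ℝ) : ℂ)) v, eq_of_toTemperedDistribution_eq ?_⟩
  rw [hT, besselPotential, Lp.toTemperedDistribution_toLp_eq, Lp.toTemperedDistribution_toLp_eq,
    fourierMultiplierCLM_toTemperedDistributionCLM_eq (by fun_prop)]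

theorem memSobolev_two_induction
    {P : Lp F 2 (volume : Measure V) → Lp F 2 (volume : Measure V) → Prop}
    (hP : IsClosed {p : Lp F 2 (volume : Measure V) × Lp F 2 (volume : Measure V) | P p.1 p.2})
    (hS : ∀ v : 𝓢(V, F), P (v.toLp 2) ((Δ v).toLp 2)) {g h : Lp F 2 (volume : Measure V)}
    (hg : MemSobolev 2 2 (g : 𝓢'(V, F))) (hgh : (h : 𝓢'(V, F)) = Δ (g : 𝓢'(V, F))) :
    P g h := by
  obtain ⟨f, hf⟩ := hg
  obtain ⟨T, hT⟩ := exists_clm_coe_eq_besselPotential (V := V) (F := F) (s := -2) (by norm_num)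
  have hBT : ∀ u, besselPotential V F 2 (T u : 𝓢'(V, F)) = u := fun u => by
    rw [← besselPotential_neg_apply_eq_iff, hT]
  let L : Lp F 2 (volume : Measure V) →L[ℂ] Lp F 2 (volume : Measure V) :=
    (2 * Real.pi) ^ 2 • (T - ContinuousLinearMap.id ℂ _)
  have hL : ∀ u, (L u : 𝓢'(V, F)) = Δ (T u : 𝓢'(V, F)) := fun u => by
    rw [laplacian_eq_smul_sub_besselPotential, hBT]
    simp only [← Lp.toTemperedDistributionCLM_apply]
    rw [← map_sub, ← ContinuousLinearMap.map_smul_of_tower]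
    rfl
  have hgT : g = T f := eq_of_toTemperedDistribution_eq <| by
    rw [hT, eq_comm, besselPotential_neg_apply_eq_iff, hf]
  have hhL : h = L f := eq_of_toTemperedDistribution_eq <| by
    rw [hL, hgh, hgT]
  rw [hgT, hhL]
  refine (SchwartzMap.denseRange_toLpCLM (p := 2) (by norm_num)).induction_on
    (p := fun u => P (T u) (L u)) f (hP.preimage (T.continuous.prodMk L.continuous)) fun v => ?_
  obtain ⟨w, hw⟩ := exists_toLp_eq_of_coe_eq_besselPotential hT v
  have hLw : L (v.toLp 2) = (Δ w).toLp 2 := eq_of_toTemperedDistribution_eq <| by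
    rw [hL, hw, Lp.toTemperedDistribution_toLp_eq, Lp.toTemperedDistribution_toLp_eq,
      laplacian_toTemperedDistributionCLM_eq]
  rw [SchwartzMap.toLpCLM_apply, hw, hLw]
  exact hS w

theorem coe_laplacianOp {d : ℕ} (g : (laplacianOp d).domain) :
    (laplacianOp d g : 𝓢'(Rd d, ℂ)) = Δ ((g : L2 d) : 𝓢'(Rd d, ℂ)) :=
  (exists_laplacian g).choose_spec

end Sobolev

section WeightedIntegral

variable {α F : Type*} {mα : MeasurableSpace α} {ν : Measure α} [NormedAddCommGroup F]
  [InnerProductSpace ℝ F] {m : α → ℝ} {C : ℝ}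

theorem integrable_mul_inner (hm : AEStronglyMeasurable m ν) (hC : ∀ x, |m x| ≤ C) {p q : α → F}
    (hp : MemLp p 2 ν) (hq : MemLp q 2 ν) : Integrable (fun x => m x * inner ℝ (p x) (q x)) ν := by
  refine Integrable.bdd_mul (c := C) ?_ hm (ae_of_all _ hC)
  refine (L2.integrable_inner (𝕜 := ℝ) (hp.toLp p) (hq.toLp q)).congr ?_
  filter_upwards [hp.coeFn_toLp, hq.coeFn_toLp] with x hpx hqx
  rw [hpx, hqx]

theorem continuous_integral_mul_inner (hm : AEStronglyMeasurable m ν) (hC : ∀ x, |m x| ≤ C) :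
    Continuous fun p : Lp F 2 ν × Lp F 2 ν => ∫ x, m x * inner ℝ (p.1 x) (p.2 x) ∂ν := by
  have hmem : MemLp m ⊤ ν := memLp_top_of_bound hm C (ae_of_all _ hC)
  let M : Lp F 2 ν →L[ℝ] Lp F 2 ν :=
    (ContinuousLinearMap.lsmul ℝ ℝ).holderL ν ⊤ 2 2 (hmem.toLp m)
  have hM : ∀ u : Lp F 2 ν, M u =ᵐ[ν] fun x => m x • u x := fun u => by
    change ⇑(hmem.toLp m • u : Lp F 2 ν) =ᵐ[ν] _
    filter_upwards [Lp.coeFn_lpSMul (r := 2) (hmem.toLp m) u, hmem.coeFn_toLp] with x hx hmx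
    rw [hx, Pi.smul_apply', hmx]
  have heq : (fun p : Lp F 2 ν × Lp F 2 ν => ∫ x, m x * inner ℝ (p.1 x) (p.2 x) ∂ν) =
      fun p => inner ℝ (M p.1) p.2 := by
    ext p
    rw [L2.inner_def]
    refine integral_congr_ae ?_
    filter_upwards [hM p.1] with x hx
    rw [hx, real_inner_smul_left]
  rw [heq]
  fun_prop

end WeightedIntegral

section Agmon

variable {V F : Type*} [NormedAddCommGroup V] [InnerProductSpace ℝ V] [FiniteDimensional ℝ V]
  [MeasurableSpace V] [BorelSpace V] [NormedAddCommGroup F] [InnerProductSpace ℝ F]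

theorem integral_mul_inner_lineDeriv_eq_neg {ρ : V → ℝ} {C C' : ℝ} (hρ : Differentiable ℝ ρ)
    (hC : ∀ x, |ρ x| ≤ C) {e : V} (hC' : ∀ x, |fderiv ℝ ρ x e| ≤ C') (v w : 𝓢(V, F)) :
    ∫ x, ρ x * inner ℝ (v x) ((∂_{e} w) x) =
      -∫ x, (ρ x * inner ℝ ((∂_{e} v) x) (w x) + fderiv ℝ ρ x e * inner ℝ (v x) (w x)) := by
  have hint : ∀ p q : 𝓢(V, F), Integrable fun x => ρ x * inner ℝ (p x) (q x) := fun p q =>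
    integrable_mul_inner hρ.continuous.aestronglyMeasurable hC (p.memLp 2) (q.memLp 2)
  have hint' : Integrable fun x => fderiv ℝ ρ x e * inner ℝ (v x) (w x) :=
    integrable_mul_inner (measurable_fderiv_apply_const ℝ ρ e).aestronglyMeasurable hC'
      (v.memLp 2) (w.memLp 2)
  have hderiv : ∀ x, HasFDerivAt (fun x => ρ x • v x)
      (ρ x • fderiv ℝ v x + (fderiv ℝ ρ x).smulRight (v x)) x := fun x =>
    (hρ x).hasFDerivAt.smul v.differentiableAt.hasFDerivAt
  have hinner : ∀ x, inner ℝ ((ρ x • fderiv ℝ v x + (fderiv ℝ ρ x).smulRight (v x)) e) (w x) =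
      ρ x * inner ℝ ((∂_{e} v) x) (w x) + fderiv ℝ ρ x e * inner ℝ (v x) (w x) := fun x => by
    rw [add_apply, smul_apply, ContinuousLinearMap.smulRight_apply, inner_add_left,
      real_inner_smul_left, real_inner_smul_left, SchwartzMap.lineDerivOp_apply_eq_fderiv]
  obtain ⟨B, hB⟩ : ∃ B : F →L[ℝ] F →L[ℝ] ℝ, ∀ p q, B p q = inner ℝ p q :=
    ⟨innerSL ℝ, fun _ _ => rfl⟩
  have hibp := integral_bilinear_hasFDerivAt_right_eq_neg_left_of_integrable (μ := volume)
    (B := B) (v := e) (g := w) (g' := fderiv ℝ w) (f := fun x => ρ x • v x)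
    (f' := fun x => ρ x • fderiv ℝ v x + (fderiv ℝ ρ x).smulRight (v x))
  simp only [hB, hinner, real_inner_smul_left,
    ← SchwartzMap.lineDerivOp_apply_eq_fderiv] at hibp
  exact hibp ((hint _ _).add hint') (hint _ _) (hint _ _) (fun x _ => hderiv x)
    fun x _ => w.differentiableAt.hasFDerivAt

theorem neg_sq_mul_inner_self_add_le (s t : ℝ) (u w : F) :
    -(s ^ 2 * inner ℝ w w + 2 * s * t * inner ℝ u w) ≤ t ^ 2 * inner ℝ u u := by
  have h := real_inner_self_nonneg (x := s • w + t • u)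
  simp only [inner_add_left, inner_add_right, real_inner_smul_left, real_inner_smul_right,
    real_inner_comm u w] at h
  linarith

theorem abs_sq_le_sq_of_abs_le {r C : ℝ} (h : |r| ≤ C) : |r ^ 2| ≤ C ^ 2 := by
  rw [abs_pow]
  exact pow_le_pow_left₀ (abs_nonneg r) h 2

variable {χ : V → ℝ} {C D : ℝ}

theorem integral_sq_mul_inner_lineDeriv_le (hχ : Differentiable ℝ χ) (hC : ∀ x, |χ x| ≤ C)
    (hD : ∀ x, ‖fderiv ℝ χ x‖ ≤ D) (v : 𝓢(V, F)) (e : V) :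
    ∫ x, χ x ^ 2 * inner ℝ (v x) ((∂_{e} (∂_{e} v)) x) ≤
      ∫ x, fderiv ℝ χ x e ^ 2 * inner ℝ (v x) (v x) := by
  have hcont : Continuous χ := hχ.continuous
  have : Measurable fun x => fderiv ℝ χ x e := measurable_fderiv_apply_const ℝ χ e
  have hDe : ∀ x, |fderiv ℝ χ x e| ≤ D * ‖e‖ := fun x => (fderiv ℝ χ x).le_of_opNorm_le (hD x) e
  have hfderiv : ∀ x, fderiv ℝ (fun x => χ x ^ 2) x e = 2 * χ x * fderiv ℝ χ x e := fun x => by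
    rw [fderiv_fun_pow _ (hχ x)]
    simp
  have hbound : ∀ x, |2 * χ x * fderiv ℝ χ x e| ≤ 2 * C * (D * ‖e‖) := fun x => by
    have hC₀ : 0 ≤ C := (abs_nonneg _).trans (hC x)
    rw [abs_mul, abs_mul, abs_two]
    gcongr
    exacts [hC x, hDe x]
  rw [integral_mul_inner_lineDeriv_eq_neg (hχ.fun_pow 2)
    (fun x => abs_sq_le_sq_of_abs_le (hC x)) (by simpa only [hfderiv] using hbound),
    ← integral_neg]
  simp only [hfderiv]
  refine integral_mono (Integrable.neg (Integrable.add ?_ ?_)) ?_ fun x =>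
    neg_sq_mul_inner_self_add_le (χ x) (fderiv ℝ χ x e) (v x) ((∂_{e} v) x)
  · exact integrable_mul_inner (by fun_prop) (fun x => abs_sq_le_sq_of_abs_le (hC x))
      ((∂_{e} v).memLp 2) ((∂_{e} v).memLp 2)
  · exact integrable_mul_inner (by fun_prop) hbound (v.memLp 2) ((∂_{e} v).memLp 2)
  · exact integrable_mul_inner (by fun_prop) (fun x => abs_sq_le_sq_of_abs_le (hDe x))
      (v.memLp 2) (v.memLp 2)

theorem integral_sq_mul_inner_laplacian_le (hχ : Differentiable ℝ χ) (hC : ∀ x, |χ x| ≤ C)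
    (hD : ∀ x, ‖fderiv ℝ χ x‖ ≤ D) (v : 𝓢(V, F)) :
    ∫ x, χ x ^ 2 * inner ℝ (v x) ((Δ v) x) ≤
      ∫ x, ‖fderiv ℝ χ x‖ ^ 2 * inner ℝ (v x) (v x) := by
  have hcont : Continuous χ := hχ.continuous
  let b := stdOrthonormalBasis ℝ V
  have hmeas : ∀ i, Measurable fun x => fderiv ℝ χ x (b i) := fun i =>
    measurable_fderiv_apply_const ℝ χ (b i)
  have hDb : ∀ i x, |fderiv ℝ χ x (b i)| ≤ D := fun i x =>
    ((fderiv ℝ χ x).unit_le_opNorm _ (b.norm_eq_one i).le).trans (hD x)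
  calc ∫ x, χ x ^ 2 * inner ℝ (v x) ((Δ v) x)
      = ∑ i, ∫ x, χ x ^ 2 * inner ℝ (v x) ((∂_{b i} (∂_{b i} v)) x) := by
        rw [← integral_finsetSum _ fun i _ => integrable_mul_inner (by fun_prop)
          (fun x => abs_sq_le_sq_of_abs_le (hC x)) (v.memLp 2) ((∂_{b i} (∂_{b i} v)).memLp 2)]
        simp only [SchwartzMap.laplacian_eq_sum b, _root_.sum_apply, inner_sum, Finset.mul_sum]
    _ ≤ ∑ i, ∫ x, fderiv ℝ χ x (b i) ^ 2 * inner ℝ (v x) (v x) :=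
        Finset.sum_le_sum fun i _ => integral_sq_mul_inner_lineDeriv_le hχ hC hD v (b i)
    _ = ∫ x, ‖fderiv ℝ χ x‖ ^ 2 * inner ℝ (v x) (v x) := by
        rw [← integral_finsetSum _ fun i _ => integrable_mul_inner
          ((hmeas i).pow_const 2).aestronglyMeasurable
          (fun x => abs_sq_le_sq_of_abs_le (hDb i x)) (v.memLp 2) (v.memLp 2)]
        simp only [b.norm_dual, Finset.sum_mul]

theorem integral_sq_mul_inner_laplacianOp_le {d : ℕ} {χ : Rd d → ℝ} (hχ : Differentiable ℝ χ)
    (hC : ∀ x, |χ x| ≤ C) (hD : ∀ x, ‖fderiv ℝ χ x‖ ≤ D) (g : (laplacianOp d).domain) :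
    ∫ x, χ x ^ 2 * inner ℝ ((g : L2 d) x) (laplacianOp d g x) ≤
      ∫ x, ‖fderiv ℝ χ x‖ ^ 2 * inner ℝ ((g : L2 d) x) ((g : L2 d) x) := by
  have hχm : AEStronglyMeasurable (fun x => χ x ^ 2) :=
    (hχ.continuous.fun_pow 2).aestronglyMeasurable
  have hDm : AEStronglyMeasurable fun x => ‖fderiv ℝ χ x‖ ^ 2 :=
    ((measurable_fderiv ℝ χ).norm.pow_const 2).aestronglyMeasurable
  have hlhs := continuous_integral_mul_inner (F := ℂ) hχm fun x => abs_sq_le_sq_of_abs_le (hC x)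
  have hrhs := continuous_integral_mul_inner (F := ℂ) hDm fun x =>
    abs_sq_le_sq_of_abs_le ((abs_norm _).trans_le (hD x))
  refine memSobolev_two_induction (P := fun u l : L2 d => ∫ x, χ x ^ 2 * inner ℝ (u x) (l x) ≤
      ∫ x, ‖fderiv ℝ χ x‖ ^ 2 * inner ℝ (u x) (u x))
    (isClosed_le hlhs (hrhs.comp (continuous_fst.prodMk continuous_fst))) (fun v => ?_)
    g.2 (coe_laplacianOp g)
  convert! integral_sq_mul_inner_laplacian_le hχ hC hD v using 1 <;> refine integral_congr_ae ?_
  · filter_upwards [v.coeFn_toLp 2, (Δ v).coeFn_toLp 2] with x hv hΔv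
    rw [hv, hΔv]
  · filter_upwards [v.coeFn_toLp 2] with x hv
    rw [hv]

theorem integral_sq_mul_inner_sub_laplacianOp_nonneg {d : ℕ} {χ : Rd d → ℝ} {a : ℝ}
    (hχ : Differentiable ℝ χ) (hC : ∀ x, |χ x| ≤ C) (ha : ∀ x, ‖fderiv ℝ χ x‖ ≤ a * |χ x|)
    (g : (laplacianOp d).domain) :
    0 ≤ ∫ x, χ x ^ 2 * inner ℝ ((g : L2 d) x) (a ^ 2 • (g : L2 d) x - laplacianOp d g x) := by
  have hD : ∀ x, ‖fderiv ℝ χ x‖ ≤ |a| * C := fun x => (ha x).trans <|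
    mul_le_mul (le_abs_self a) (hC x) (abs_nonneg _) (abs_nonneg a)
  have hDm : AEStronglyMeasurable fun x => ‖fderiv ℝ χ x‖ ^ 2 :=
    ((measurable_fderiv ℝ χ).norm.pow_const 2).aestronglyMeasurable
  have hint : ∀ u v : L2 d, Integrable fun x => χ x ^ 2 * inner ℝ (u x) (v x) := fun u v =>
    integrable_mul_inner (hχ.continuous.fun_pow 2).aestronglyMeasurable
      (fun x => abs_sq_le_sq_of_abs_le (hC x)) (Lp.memLp u) (Lp.memLp v)
  have hint' : Integrable fun x => ‖fderiv ℝ χ x‖ ^ 2 * inner ℝ ((g : L2 d) x) ((g : L2 d) x) :=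
    integrable_mul_inner hDm
      (fun x => abs_sq_le_sq_of_abs_le ((abs_norm _).trans_le (hD x))) (Lp.memLp _) (Lp.memLp _)
  have hgrad : ∫ x, ‖fderiv ℝ χ x‖ ^ 2 * inner ℝ ((g : L2 d) x) ((g : L2 d) x) ≤
      ∫ x, a ^ 2 * (χ x ^ 2 * inner ℝ ((g : L2 d) x) ((g : L2 d) x)) := by
    refine integral_mono hint' ((hint _ _).const_mul _) fun x => ?_
    have hsq : ‖fderiv ℝ χ x‖ ^ 2 ≤ a ^ 2 * χ x ^ 2 := by
      rw [← sq_abs (χ x), ← mul_pow]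
      exact pow_le_pow_left₀ (norm_nonneg _) (ha x) 2
    simpa only [mul_assoc] using mul_le_mul_of_nonneg_right hsq real_inner_self_nonneg
  simp only [inner_sub_right, real_inner_smul_right, mul_sub, mul_left_comm _ (a ^ 2)]
  rw [integral_sub ((hint _ _).const_mul _) (hint _ _), sub_nonneg]
  exact (integral_sq_mul_inner_laplacianOp_le hχ hC hD g).trans hgrad

end Agmon

section Weights

variable {V : Type*} [NormedAddCommGroup V] {a ε : ℝ}

/-- The Japanese bracket `⟨x⟩`, a smooth substitute for the norm. -/
def japaneseBracket (x : V) : ℝ :=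
  √(1 + ‖x‖ ^ 2)

/-- The Japanese bracket damped to the bounded function `⟨x⟩ / (1 + ε⟨x⟩)`. -/
def dampedBracket (ε : ℝ) (x : V) : ℝ :=
  japaneseBracket x / (1 + ε * japaneseBracket x)

/-- The weight `exp (a⟨x⟩ / (1 + ε⟨x⟩))`: for `ε > 0` it is a bounded approximation of
`exp (a⟨x⟩)`. -/
def expWeight (a ε : ℝ) (x : V) : ℝ :=
  Real.exp (a * dampedBracket ε x)

theorem japaneseBracket_pos (x : V) : 0 < japaneseBracket x := by
  unfold japaneseBracket; positivity

theorem norm_le_japaneseBracket (x : V) : ‖x‖ ≤ japaneseBracket x :=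
  Real.le_sqrt_of_sq_le (by linarith)

theorem japaneseBracket_le_one_add_norm (x : V) : japaneseBracket x ≤ 1 + ‖x‖ := by
  rw [japaneseBracket, Real.sqrt_le_left (by positivity)]
  linarith [norm_nonneg x, add_sq 1 ‖x‖]

theorem one_add_mul_japaneseBracket_pos (hε : 0 ≤ ε) (x : V) : 0 < 1 + ε * japaneseBracket x := by
  have := japaneseBracket_pos x
  positivity

theorem dampedBracket_le_japaneseBracket (hε : 0 ≤ ε) (x : V) :
    dampedBracket ε x ≤ japaneseBracket x :=
  div_le_self (japaneseBracket_pos x).le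
    (le_add_of_nonneg_right (mul_nonneg hε (japaneseBracket_pos x).le))

theorem dampedBracket_le_inv (hε : 0 < ε) (x : V) : dampedBracket ε x ≤ ε⁻¹ := by
  rw [dampedBracket, div_le_iff₀ (one_add_mul_japaneseBracket_pos hε.le x), mul_add,
    inv_mul_cancel_left₀ hε.ne', mul_one]
  exact le_add_of_nonneg_left (by positivity)

theorem expWeight_pos (a ε : ℝ) (x : V) : 0 < expWeight a ε x :=
  Real.exp_pos _

theorem expWeight_le_exp_mul_inv (ha : 0 ≤ a) (hε : 0 < ε) (x : V) :
    expWeight a ε x ≤ Real.exp (a * ε⁻¹) :=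
  Real.exp_le_exp.2 (mul_le_mul_of_nonneg_left (dampedBracket_le_inv hε x) ha)

theorem expWeight_sq_le (ha : 0 ≤ a) (hε : 0 < ε) (x : V) :
    expWeight a ε x ^ 2 ≤ Real.exp (a * ε⁻¹) ^ 2 :=
  pow_le_pow_left₀ (expWeight_pos a ε x).le (expWeight_le_exp_mul_inv ha hε x) 2

theorem expWeight_le_exp_mul_one_add_norm (ha : 0 ≤ a) (hε : 0 ≤ ε) (x : V) :
    expWeight a ε x ≤ Real.exp (a * (1 + ‖x‖)) :=
  Real.exp_le_exp.2 (mul_le_mul_of_nonneg_left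
    ((dampedBracket_le_japaneseBracket hε x).trans (japaneseBracket_le_one_add_norm x)) ha)

theorem tendsto_expWeight (a : ℝ) (x : V) :
    Tendsto (fun ε => expWeight a ε x) (𝓝 0) (𝓝 (Real.exp (a * japaneseBracket x))) := by
  have hcont : ContinuousAt (fun ε => expWeight a ε x) 0 := by
    unfold expWeight dampedBracket
    fun_prop (disch := simp)
  simpa [expWeight, dampedBracket] using hcont.tendsto

theorem lipschitzWith_japaneseBracket : LipschitzWith 1 (japaneseBracket : V → ℝ) := by
  have hnorm : ∀ (r : ℝ) (x : V), √(r ^ 2 + ‖x‖ ^ 2) = ‖WithLp.toLp 2 (r, x)‖ := fun r x => by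
    simp [WithLp.prod_norm_eq_of_L2]
  refine LipschitzWith.of_dist_le_mul fun x y => ?_
  have h := abs_norm_sub_norm_le (WithLp.toLp 2 ((1 : ℝ), x)) (WithLp.toLp 2 ((1 : ℝ), y))
  rw [← WithLp.toLp_sub, Prod.mk_sub_mk, sub_self, ← hnorm, ← hnorm, ← hnorm] at h
  simpa [japaneseBracket, Real.dist_eq, dist_eq_norm] using h

theorem lipschitzWith_dampedBracket (hε : 0 ≤ ε) : LipschitzWith 1 (dampedBracket ε : V → ℝ) := by
  refine LipschitzWith.of_dist_le_mul fun x y => ?_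
  have hx := one_add_mul_japaneseBracket_pos hε x
  have hy := one_add_mul_japaneseBracket_pos hε y
  have hone : 1 ≤ (1 + ε * japaneseBracket x) * (1 + ε * japaneseBracket y) :=
    one_le_mul_of_one_le_of_one_le
      (le_add_of_nonneg_right (mul_nonneg hε (japaneseBracket_pos x).le))
      (le_add_of_nonneg_right (mul_nonneg hε (japaneseBracket_pos y).le))
  have hdiff : dampedBracket ε x - dampedBracket ε y = (japaneseBracket x - japaneseBracket y) /
      ((1 + ε * japaneseBracket x) * (1 + ε * japaneseBracket y)) := by
    rw [dampedBracket, dampedBracket, div_sub_div _ _ hx.ne' hy.ne']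
    ring
  rw [Real.dist_eq, hdiff, abs_div, abs_of_pos (mul_pos hx hy)]
  exact (div_le_self (abs_nonneg _) hone).trans (lipschitzWith_japaneseBracket.dist_le_mul x y)

variable [InnerProductSpace ℝ V]

theorem differentiable_dampedBracket (hε : 0 ≤ ε) :
    Differentiable ℝ (dampedBracket ε : V → ℝ) := by
  have hJ : Differentiable ℝ (japaneseBracket : V → ℝ) := fun x =>
    ((differentiableAt_id.norm_sq ℝ).const_add 1).sqrt (by positivity)
  have hden : Differentiable ℝ fun x : V => 1 + ε * japaneseBracket x :=
    (hJ.const_mul ε).const_add 1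
  exact hJ.mul (hden.inv fun x => (one_add_mul_japaneseBracket_pos hε x).ne')

theorem differentiable_expWeight (hε : 0 ≤ ε) : Differentiable ℝ (expWeight a ε : V → ℝ) :=
  ((differentiable_dampedBracket hε).const_mul a).exp

theorem norm_fderiv_expWeight_le (ha : 0 ≤ a) (hε : 0 ≤ ε) (x : V) :
    ‖fderiv ℝ (expWeight a ε) x‖ ≤ a * |expWeight a ε x| := by
  have hd : DifferentiableAt ℝ (dampedBracket ε) x := differentiable_dampedBracket hε x
  have hfderiv : fderiv ℝ (expWeight a ε) x =
      expWeight a ε x • a • fderiv ℝ (dampedBracket ε) x :=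
    (((hd.hasFDerivAt).const_mul a).exp).fderiv
  have hone : ‖fderiv ℝ (dampedBracket ε) x‖ ≤ 1 :=
    norm_fderiv_le_of_lipschitz ℝ (lipschitzWith_dampedBracket hε)
  rw [hfderiv, norm_smul, norm_smul, Real.norm_eq_abs, Real.norm_of_nonneg ha, mul_comm]
  gcongr
  exact mul_le_of_le_one_right ha hone

end Weights

section ExpDecay

theorem integral_mul_le_of_integral_mul_nonneg {α : Type*} {mα : MeasurableSpace α}
    {ν : Measure α} {w f g T : α → ℝ} {M C : ℝ} (hwm : AEStronglyMeasurable w ν)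
    (hw : ∀ x, 0 ≤ w x) (hwC : ∀ x, w x ≤ C) (hf : Integrable f ν) (hg : Integrable g ν)
    (hT : Integrable T ν) (hwT : 0 ≤ ∫ x, w x * T x ∂ν) (hM : 0 ≤ M)
    (hle : ∀ᵐ x ∂ν, w x ≤ M ∨ T x ≤ g x - f x) :
    ∫ x, w x * f x ∂ν ≤ M * (∫ x, |T x + f x - g x| ∂ν) + ∫ x, w x * g x ∂ν := by
  have hmul : ∀ {h : α → ℝ}, Integrable h ν → Integrable (fun x => w x * h x) ν := fun hh =>
    hh.bdd_mul hwm (ae_of_all _ fun x => (abs_of_nonneg (hw x)).trans_le (hwC x))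
  have hpt : ∀ᵐ x ∂ν, w x * (T x + f x - g x) ≤ M * |T x + f x - g x| := by
    filter_upwards [hle] with x hx
    rcases hx with hx | hx
    · exact (mul_le_mul_of_nonneg_left (le_abs_self _) (hw x)).trans
        (mul_le_mul_of_nonneg_right hx (abs_nonneg _))
    · exact (mul_nonpos_of_nonneg_of_nonpos (hw x) (by linarith)).trans (by positivity)
  have hS : Integrable (fun x => T x + f x - g x) ν := (hT.add hf).sub hg
  have hwTf : Integrable (fun x => w x * T x + w x * f x) ν := (hmul hT).add (hmul hf)
  have hint := integral_mono_ae (hmul hS) (hS.abs.const_mul M) hpt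
  have hsplit : ∫ x, w x * (T x + f x - g x) ∂ν =
      ∫ x, w x * T x ∂ν + ∫ x, w x * f x ∂ν - ∫ x, w x * g x ∂ν := by
    simp only [mul_sub, mul_add]
    rw [integral_sub hwTf (hmul hg), integral_add (hmul hT) (hmul hf)]
  rw [hsplit, integral_const_mul] at hint
  linarith

variable {V F : Type*} [NormedAddCommGroup V] [InnerProductSpace ℝ V] [MeasurableSpace V]
  [BorelSpace V] {ν : Measure V} [NormedAddCommGroup F] {a ε : ℝ} {φ ψ : V → F}

theorem aestronglyMeasurable_expWeight (hε : 0 ≤ ε) : AEStronglyMeasurable (expWeight a ε) ν :=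
  (differentiable_expWeight hε).continuous.aestronglyMeasurable

theorem integrable_expWeight_sq_mul_norm_sq (ha : 0 ≤ a) (hε : 0 < ε)
    (hφ : MemLp φ 2 ν) : Integrable (fun x => expWeight a ε x ^ 2 * ‖φ x‖ ^ 2) ν :=
  ((memLp_two_iff_integrable_sq_norm hφ.1).1 hφ).bdd_mul
    ((aestronglyMeasurable_expWeight hε.le).pow 2) (ae_of_all _ fun x =>
      (abs_of_nonneg (sq_nonneg _)).trans_le (expWeight_sq_le ha hε x))

variable [NormedSpace ℝ F]

/-- Exponential decay at rate `a` in the `L²` sense: `e^{a|x|} f ∈ L²(ν)`. -/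
def HasExpDecay (a : ℝ) (f : V → F) (ν : Measure V) : Prop :=
  MemLp (fun x => Real.exp (a * ‖x‖) • f x) 2 ν

theorem integral_expWeight_sq_mul_norm_sq_le (ha : 0 ≤ a) (hε : 0 < ε)
    (hψ : MemLp ψ 2 ν) (hdecay : HasExpDecay a ψ ν) :
    ∫ x, expWeight a ε x ^ 2 * ‖ψ x‖ ^ 2 ∂ν ≤
      ∫ x, Real.exp a ^ 2 * ‖Real.exp (a * ‖x‖) • ψ x‖ ^ 2 ∂ν := by
  refine integral_mono (integrable_expWeight_sq_mul_norm_sq ha hε hψ)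
    (((memLp_two_iff_integrable_sq_norm hdecay.1).1 hdecay).const_mul _) fun x => ?_
  calc expWeight a ε x ^ 2 * ‖ψ x‖ ^ 2
      ≤ Real.exp (a * (1 + ‖x‖)) ^ 2 * ‖ψ x‖ ^ 2 := by
        have := (expWeight_pos a ε x).le
        gcongr
        exact expWeight_le_exp_mul_one_add_norm ha hε.le x
    _ = Real.exp a ^ 2 * ‖Real.exp (a * ‖x‖) • ψ x‖ ^ 2 := by
        rw [norm_smul, Real.norm_of_nonneg (Real.exp_pos _).le, mul_add, Real.exp_add, mul_one]
        ring

theorem hasExpDecay_of_integral_expWeight_sq_le (ha : 0 ≤ a) (hφ : MemLp φ 2 ν) {B : ℝ}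
    (hB : ∀ ε > 0, ∫ x, expWeight a ε x ^ 2 * ‖φ x‖ ^ 2 ∂ν ≤ B) : HasExpDecay a φ ν := by
  let δ : ℕ → ℝ := fun n => 1 / ((n : ℝ) + 1)
  have hδ : ∀ n, 0 < δ n := fun n => by positivity
  have hmem : ∀ n, MemLp (fun x => expWeight a (δ n) x • φ x) 2 ν := fun n => by
    refine (memLp_two_iff_integrable_sq_norm
      ((aestronglyMeasurable_expWeight (hδ n).le).smul hφ.1)).2 ?_
    simpa only [Pi.smul_apply', norm_smul, mul_pow, Real.norm_eq_abs, sq_abs] using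
      integrable_expWeight_sq_mul_norm_sq ha (hδ n) hφ
  have hbound : ∀ n, eLpNorm (fun x => expWeight a (δ n) x • φ x) 2 ν ≤
      ENNReal.ofReal (B ^ (2 : ℝ)⁻¹) := fun n => by
    rw [(hmem n).eLpNorm_eq_integral_rpow_norm two_ne_zero ENNReal.ofNat_ne_top]
    simp only [ENNReal.toReal_ofNat, Real.rpow_two, norm_smul, mul_pow, Real.norm_eq_abs, sq_abs]
    gcongr
    exact hB _ (hδ n)
  have hfatou : eLpNorm (fun x => Real.exp (a * japaneseBracket x) • φ x) 2 ν ≤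
      ENNReal.ofReal (B ^ (2 : ℝ)⁻¹) :=
    (Lp.eLpNorm_lim_le_liminf_eLpNorm (fun n => (hmem n).1) _ (ae_of_all _ fun x =>
      ((tendsto_expWeight a x).comp tendsto_one_div_add_atTop_nhds_zero_nat).smul_const _)).trans
      (liminf_le_of_frequently_le' (Frequently.of_forall hbound))
  refine MemLp.mono (g := fun x => Real.exp (a * japaneseBracket x) • φ x)
    ⟨?_, hfatou.trans_lt ENNReal.ofReal_lt_top⟩ ?_ (ae_of_all _ fun x => ?_)
  · exact AEStronglyMeasurable.smul (by unfold japaneseBracket; fun_prop) hφ.1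
  · exact AEStronglyMeasurable.smul (by fun_prop) hφ.1
  · rw [norm_smul, norm_smul, Real.norm_of_nonneg (by positivity),
      Real.norm_of_nonneg (by positivity)]
    gcongr
    exact norm_le_japaneseBracket x

theorem hasExpDecay_of_integral_expWeight_sq_mul_nonneg {c K R : ℝ} (ha : 0 ≤ a) (hc : 0 < c)
    (hK : 0 ≤ K) (hφ : MemLp φ 2 ν) (hψ : MemLp ψ 2 ν) {T : V → ℝ} (hT : Integrable T ν)
    (hpos : ∀ ε > 0, 0 ≤ ∫ x, expWeight a ε x ^ 2 * T x ∂ν)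
    (hle : ∀ᵐ x ∂ν, R ≤ ‖x‖ → T x ≤ K * ‖ψ x‖ ^ 2 - c * ‖φ x‖ ^ 2)
    (hdecay : HasExpDecay a ψ ν) : HasExpDecay a φ ν := by
  let S : V → ℝ := fun x => T x + c * ‖φ x‖ ^ 2 - K * ‖ψ x‖ ^ 2
  let B : ℝ := Real.exp (a * (1 + R)) ^ 2 * (∫ x, |S x| ∂ν) +
    K * ∫ x, Real.exp a ^ 2 * ‖Real.exp (a * ‖x‖) • ψ x‖ ^ 2 ∂ν
  refine hasExpDecay_of_integral_expWeight_sq_le ha hφ (B := c⁻¹ * B) fun ε hε => ?_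
  have hsmall : ∀ x : V, ‖x‖ ≤ R → expWeight a ε x ^ 2 ≤ Real.exp (a * (1 + R)) ^ 2 := by
    intro x hx
    refine pow_le_pow_left₀ (expWeight_pos a ε x).le ?_ 2
    exact (expWeight_le_exp_mul_one_add_norm ha hε.le x).trans (by gcongr)
  have hcompare := integral_mul_le_of_integral_mul_nonneg (f := fun x => c * ‖φ x‖ ^ 2)
    (g := fun x => K * ‖ψ x‖ ^ 2) (M := Real.exp (a * (1 + R)) ^ 2)
    ((aestronglyMeasurable_expWeight hε.le).pow 2) (fun x => sq_nonneg _) (expWeight_sq_le ha hε)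
    (((memLp_two_iff_integrable_sq_norm hφ.1).1 hφ).const_mul c)
    (((memLp_two_iff_integrable_sq_norm hψ.1).1 hψ).const_mul K) hT (hpos ε hε) (by positivity)
    (hle.mono fun x hx => (le_total ‖x‖ R).imp (hsmall x) hx)
  simp only [Pi.pow_apply, mul_left_comm _ c, mul_left_comm _ K, integral_const_mul] at hcompare
  rw [le_inv_mul_iff₀ hc]
  exact hcompare.trans (add_le_add_right (mul_le_mul_of_nonneg_left
    (integral_expWeight_sq_mul_norm_sq_le ha hε hψ hdecay) hK) _)

end ExpDecay

section Operators

theorem exists_opPow_succ_apply_eq {H : Type*} [AddCommGroup H] [Module ℂ H] {T : H →ₗ.[ℂ] H}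
    {k : ℕ} (φ : (opPow T (k + 1)).domain) :
    ∃ ψ : T.domain, (ψ : H) = φ ∧
      ∃ h : T ψ ∈ (opPow T k).domain, opPow T (k + 1) φ = opPow T k ⟨T ψ, h⟩ := by
  obtain ⟨φ, hφd⟩ := φ
  obtain ⟨⟨y, hy, hyφ⟩, hφT⟩ := id hφd
  exact ⟨⟨φ, hφT⟩, rfl, by subst hyφ; exact hy, rfl⟩

variable {d : ℕ}

theorem coeFn_component (j : Fin 2) (φ : L2C2 d) : component j φ =ᵐ[volume] fun x => φ x j :=
  ContinuousLinearMap.coeFn_compLpL _ φ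

theorem component_inclusion (i j : Fin 2) (f : L2 d) :
    component i (inclusion j f) = if i = j then f else 0 := by
  apply Lp.ext
  have h : inclusion j f =ᵐ[volume] fun x => f x • (EuclideanSpace.single j (1 : ℂ) : C2) :=
    ContinuousLinearMap.coeFn_compLpL _ f
  filter_upwards [coeFn_component i (inclusion j f), h,
    Lp.coeFn_zero ℂ 2 (volume : Measure (Rd d))] with x hcomponent hinclusion hzero
  rw [hcomponent, hinclusion]
  split_ifs with hij
  · simp [hij]
  · rw [hzero]
    simp [hij]

theorem component_matrixOp (A : Fin 2 → Fin 2 → (L2 d →ₗ.[ℂ] L2 d)) (φ : (matrixOp A).domain)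
    (i : Fin 2) (h : ∀ j, component j (φ : L2C2 d) ∈ (A i j).domain) :
    component i (matrixOp A φ) = ∑ j, A i j ⟨component j (φ : L2C2 d), h j⟩ := by
  change component i (∑ i, inclusion i (∑ j, A i j ⟨component j (φ : L2C2 d), _⟩)) = _
  rw [map_sum]
  simp only [component_inclusion, Finset.sum_ite_eq, Finset.mem_univ, if_true]

variable {μ : ℝ} {U W : Rd d → ℝ}

theorem component_mem_domain (φ : (systemOp μ U W).domain) (j : Fin 2) :
    component j (φ : L2C2 d) ∈ (laplacianOp d).domain ∧
      component j (φ : L2C2 d) ∈ mulDomain U ∧ component (1 - j) (φ : L2C2 d) ∈ mulDomain W := by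
  have hd := φ.2
  simp only [systemOp, matrixOp, Submodule.mem_iInf, Submodule.mem_comap] at hd
  fin_cases j
  · exact ⟨(hd 0 0).1.1, (hd 0 0).2, hd 0 1⟩
  · exact ⟨(hd 1 1).1.1, (hd 1 1).2, hd 1 0⟩

theorem laplacianOp_component (φ : (systemOp μ U W).domain) (j : Fin 2) :
    laplacianOp d ⟨component j (φ : L2C2 d), (component_mem_domain φ j).1⟩ =
      (μ : ℂ) • component j (φ : L2C2 d) + mulFun U ⟨_, (component_mem_domain φ j).2.1⟩ +
        mulFun W ⟨_, (component_mem_domain φ j).2.2⟩ -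
        (-1 : ℂ) ^ (j : ℕ) • component j (systemOp μ U W φ) := by
  have hd := φ.2
  simp only [systemOp, matrixOp, Submodule.mem_iInf, Submodule.mem_comap] at hd
  have hrow := component_matrixOp _ φ j (hd j)
  rw [Fin.sum_univ_two] at hrow
  fin_cases j
  · have hrow' : component 0 (systemOp μ U W φ) =
        -laplacianOp d ⟨_, (component_mem_domain φ 0).1⟩ + (μ : ℂ) • component 0 (φ : L2C2 d) +
          mulFun U ⟨_, (component_mem_domain φ 0).2.1⟩ +
          mulFun W ⟨_, (component_mem_domain φ 0).2.2⟩ := hrow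
    simp only [Fin.zero_eta, hrow', pow_zero, one_smul]
    abel
  · have hrow' : component 1 (systemOp μ U W φ) =
        -mulFun W ⟨_, (component_mem_domain φ 1).2.2⟩ +
          (laplacianOp d ⟨_, (component_mem_domain φ 1).1⟩ - (μ : ℂ) • component 1 (φ : L2C2 d) -
            mulFun U ⟨_, (component_mem_domain φ 1).2.1⟩) := hrow
    simp only [Fin.mk_one, hrow', pow_one, neg_smul, one_smul]
    abel

theorem coeFn_laplacianOp_component (φ : (systemOp μ U W).domain) (j : Fin 2) :
    ∀ᵐ x, laplacianOp d ⟨component j (φ : L2C2 d), (component_mem_domain φ j).1⟩ x =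
      (μ + U x) * (φ : L2C2 d) x j + W x * (φ : L2C2 d) x (1 - j) -
        (-1) ^ (j : ℕ) * (systemOp μ U W φ : L2C2 d) x j := by
  rw [laplacianOp_component]
  have hμU := (Lp.coeFn_add _ _).trans ((Lp.coeFn_smul (μ : ℂ) (component j (φ : L2C2 d))).add
    (coeFn_mulFun U ⟨_, (component_mem_domain φ j).2.1⟩))
  have hμUW := (Lp.coeFn_add _ _).trans
    (hμU.add (coeFn_mulFun W ⟨_, (component_mem_domain φ j).2.2⟩))
  have hrow := (Lp.coeFn_sub _ _).trans
    (hμUW.sub (Lp.coeFn_smul ((-1 : ℂ) ^ (j : ℕ)) (component j (systemOp μ U W φ))))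
  filter_upwards [hrow, coeFn_component j (φ : L2C2 d), coeFn_component (1 - j) (φ : L2C2 d),
    coeFn_component j (systemOp μ U W φ)] with x hx hφ hφrev hHφ
  simp only [hx, Pi.sub_apply, Pi.add_apply, Pi.smul_apply, smul_eq_mul, hφ, hφrev, hHφ, add_mul]

end Operators

section Decay

theorem inner_smul_sub_le {a c s μ p q : ℝ} {E u v ψ : ℂ} (hc : 0 < c) (hs : |s| ≤ 1) :
    inner ℝ u (a ^ 2 • u - ((μ + p) * u + q * v - s * (E * u + ψ))) ≤
      (a ^ 2 - μ + |E.re| + |p| + c) * ‖u‖ ^ 2 + |q| * ((‖u‖ ^ 2 + ‖v‖ ^ 2) / 2) +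
        (4 * c)⁻¹ * ‖ψ‖ ^ 2 := by
  have hexpand : inner ℝ u (a ^ 2 • u - ((μ + p) * u + q * v - s * (E * u + ψ))) =
      (a ^ 2 - μ) * ‖u‖ ^ 2 + s * E.re * ‖u‖ ^ 2 + -p * ‖u‖ ^ 2 + -(q * inner ℝ u v) +
        s * inner ℝ u ψ := by
    simp only [Complex.inner, Complex.sq_norm, Complex.normSq_apply, Complex.real_smul,
      Complex.mul_re, Complex.sub_re, Complex.add_re, Complex.conj_re, Complex.conj_im,
      Complex.mul_im, Complex.sub_im, Complex.add_im, Complex.ofReal_re, Complex.ofReal_im]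
    ring
  have hE : s * E.re ≤ |E.re| :=
    (le_abs_self _).trans ((abs_mul s _).trans_le (mul_le_of_le_one_left (abs_nonneg _) hs))
  have hq : -(q * inner ℝ u v) ≤ |q| * ((‖u‖ ^ 2 + ‖v‖ ^ 2) / 2) :=
    calc -(q * inner ℝ u v) ≤ |q| * |inner ℝ u v| := (neg_le_abs _).trans_eq (abs_mul _ _)
      _ ≤ |q| * (‖u‖ * ‖v‖) := by gcongr; exact abs_real_inner_le_norm u v
      _ ≤ |q| * ((‖u‖ ^ 2 + ‖v‖ ^ 2) / 2) := by
        gcongr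
        linarith [two_mul_le_add_sq ‖u‖ ‖v‖]
  have hψ : s * inner ℝ u ψ ≤ c * ‖u‖ ^ 2 + (4 * c)⁻¹ * ‖ψ‖ ^ 2 :=
    calc s * inner ℝ u ψ ≤ |s| * |inner ℝ u ψ| := (le_abs_self _).trans_eq (abs_mul _ _)
      _ ≤ 1 * (‖u‖ * ‖ψ‖) := by gcongr; exact abs_real_inner_le_norm u ψ
      _ = c * ‖u‖ ^ 2 + (4 * c)⁻¹ * ‖ψ‖ ^ 2 - (4 * c)⁻¹ * (2 * c * ‖u‖ - ‖ψ‖) ^ 2 := by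
        field_simp
        ring
      _ ≤ c * ‖u‖ ^ 2 + (4 * c)⁻¹ * ‖ψ‖ ^ 2 := sub_le_self _ (by positivity)
  have hEu := mul_le_mul_of_nonneg_right hE (sq_nonneg ‖u‖)
  have hpu := mul_le_mul_of_nonneg_right (neg_le_abs p) (sq_nonneg ‖u‖)
  rw [hexpand]
  linarith

variable {d : ℕ}

theorem exists_forall_ae_of_eventually_cocompact_inf_ae {V : Type*} [SeminormedAddCommGroup V]
    [MeasurableSpace V] {ν : Measure V} {p : V → Prop} (h : ∀ᶠ x in cocompact V ⊓ ae ν, p x) :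
    ∃ R : ℝ, ∀ᵐ x ∂ν, R ≤ ‖x‖ → p x := by
  obtain ⟨s, hs, t, ht, hst⟩ := eventually_inf.1 h
  obtain ⟨R, hR⟩ := Metric.closedBall_compl_subset_of_mem_cocompact hs 0
  refine ⟨R + 1, ?_⟩
  filter_upwards [ht] with x hx hxR
  refine hst x ⟨hR ?_, hx⟩
  rw [Set.mem_compl_iff, mem_closedBall_zero_iff, not_le]
  linarith

theorem TendsToZeroAtInfinity.eventually_abs_add_abs_le {U W : Rd d → ℝ}
    (hU : TendsToZeroAtInfinity U) (hW : TendsToZeroAtInfinity W) {η : ℝ} (hη : 0 < η) :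
    ∀ᶠ x in cocompact (Rd d) ⊓ ae volume, |U x| + |W x| ≤ η := by
  have hlim : Tendsto (fun x => |U x| + |W x|) (cocompact (Rd d) ⊓ ae volume) (𝓝 0) := by
    simpa only [abs_zero, add_zero] using (Tendsto.abs hU).add (Tendsto.abs hW)
  exact hlim.eventually_le_const hη

theorem hasExpDecay_zero (a : ℝ) : HasExpDecay a (0 : L2C2 d) volume :=
  (memLp_congr_ae ((Lp.coeFn_zero C2 2 volume).mono fun x hx => by
    rw [hx, Pi.zero_apply, smul_zero])).2 (MemLp.zero (ε := C2))

theorem integrable_inner_smul_sub_laplacianOp (b : ℝ) (g : (laplacianOp d).domain) :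
    Integrable (fun x => inner ℝ ((g : L2 d) x) (b • (g : L2 d) x - laplacianOp d g x)) := by
  simpa only [one_mul, Pi.sub_apply, Pi.smul_apply] using integrable_mul_inner
    (m := fun _ => 1) (C := 1) aestronglyMeasurable_const (by simp) (Lp.memLp (g : L2 d))
    (((Lp.memLp (g : L2 d)).const_smul b).sub (Lp.memLp (laplacianOp d g)))

theorem integral_expWeight_sq_mul_sum_inner_nonneg {ι : Type*} [Fintype ι] {a ε : ℝ} (ha : 0 ≤ a)
    (hε : 0 < ε) (g : ι → (laplacianOp d).domain) :
    0 ≤ ∫ x, expWeight a ε x ^ 2 *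
      ∑ j, inner ℝ ((g j : L2 d) x) (a ^ 2 • (g j : L2 d) x - laplacianOp d (g j) x) := by
  have hint : ∀ j, Integrable fun x => expWeight a ε x ^ 2 *
      inner ℝ ((g j : L2 d) x) (a ^ 2 • (g j : L2 d) x - laplacianOp d (g j) x) := fun j =>
    (integrable_inner_smul_sub_laplacianOp (a ^ 2) (g j)).bdd_mul
      ((aestronglyMeasurable_expWeight hε.le).pow 2) (ae_of_all _ fun x =>
        (abs_of_nonneg (sq_nonneg _)).trans_le (expWeight_sq_le ha hε x))
  simp only [Finset.mul_sum]
  rw [integral_finsetSum _ fun j _ => hint j]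
  exact Finset.sum_nonneg fun j _ => integral_sq_mul_inner_sub_laplacianOp_nonneg
    (differentiable_expWeight hε.le)
    (fun x => (abs_of_pos (expWeight_pos a ε x)).trans_le (expWeight_le_exp_mul_inv ha hε x))
    (norm_fderiv_expWeight_le ha hε.le) (g j)

variable {μ a c η : ℝ} {U W : Rd d → ℝ} {E : ℂ}

theorem ae_sum_inner_smul_sub_laplacianOp_le (hc : 0 < c) (hη : a ^ 2 + |E.re| + η + 2 * c ≤ μ)
    (φ : (systemOp μ U W - scalarOp (L2C2 d) E).domain) :
    ∀ᵐ x, |U x| + |W x| ≤ η →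
      ∑ j, inner ℝ (component j (φ : L2C2 d) x) (a ^ 2 • component j (φ : L2C2 d) x -
        laplacianOp d ⟨_, (component_mem_domain ⟨φ, φ.2.1⟩ j).1⟩ x) ≤
      (4 * c)⁻¹ * ‖((systemOp μ U W - scalarOp (L2C2 d) E) φ : L2C2 d) x‖ ^ 2 -
        c * ‖(φ : L2C2 d) x‖ ^ 2 := by
  set ψ : L2C2 d := (systemOp μ U W - scalarOp (L2C2 d) E) φ
  have hψ : systemOp μ U W ⟨φ, φ.2.1⟩ = E • (φ : L2C2 d) + ψ := by
    rw [add_comm, ← sub_eq_iff_eq_add]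
    rfl
  have hcoe := (Lp.coeFn_add (E • (φ : L2C2 d)) ψ).trans
    ((Lp.coeFn_smul E (φ : L2C2 d)).add EventuallyEq.rfl)
  filter_upwards [ae_all_iff.2 fun j => coeFn_component j (φ : L2C2 d),
    ae_all_iff.2 (coeFn_laplacianOp_component ⟨φ, φ.2.1⟩), hcoe] with x hφx hΔx hψx hUW
  have hrow : ∀ j, inner ℝ (component j (φ : L2C2 d) x) (a ^ 2 • component j (φ : L2C2 d) x -
      laplacianOp d ⟨_, (component_mem_domain ⟨φ, φ.2.1⟩ j).1⟩ x) ≤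
      (a ^ 2 - μ + |E.re| + |U x| + c) * ‖(φ : L2C2 d) x j‖ ^ 2 +
        |W x| * ((‖(φ : L2C2 d) x j‖ ^ 2 + ‖(φ : L2C2 d) x (1 - j)‖ ^ 2) / 2) +
        (4 * c)⁻¹ * ‖ψ x j‖ ^ 2 := fun j => by
    have hbound := inner_smul_sub_le (a := a) (μ := μ) (p := U x) (q := W x) (E := E)
      (u := (φ : L2C2 d) x j) (v := (φ : L2C2 d) x (1 - j)) (ψ := ψ x j) (s := (-1) ^ (j : ℕ)) hc
      (by simp)
    rw [hφx j, hΔx j, hψ, hψx]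
    simpa using hbound
  have hUWφ := mul_le_mul_of_nonneg_right hUW (sq_nonneg ‖(φ : L2C2 d) x‖)
  have hηφ := mul_le_mul_of_nonneg_right hη (sq_nonneg ‖(φ : L2C2 d) x‖)
  simp only [EuclideanSpace.norm_sq_eq, Fin.sum_univ_two] at hUWφ hηφ ⊢
  have h0 := hrow 0
  have h1 := hrow 1
  simp only [sub_zero, sub_self] at h0 h1
  linarith

theorem hasExpDecay_of_systemOp_sub_scalarOp (ha : 0 ≤ a) (hη : a ^ 2 + |E.re| + η < μ)
    (hUW : ∀ᶠ x in cocompact (Rd d) ⊓ ae volume, |U x| + |W x| ≤ η)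
    (φ : (systemOp μ U W - scalarOp (L2C2 d) E).domain)
    (hψ : HasExpDecay a ((systemOp μ U W - scalarOp (L2C2 d) E) φ) volume) :
    HasExpDecay a (φ : L2C2 d) volume := by
  obtain ⟨R, hR⟩ := exists_forall_ae_of_eventually_cocompact_inf_ae hUW
  obtain ⟨c, hc, hηc⟩ : ∃ c > 0, a ^ 2 + |E.re| + η + 2 * c ≤ μ :=
    ⟨(μ - a ^ 2 - |E.re| - η) / 2, by linarith, by linarith⟩
  let φ' : (systemOp μ U W).domain := ⟨φ, φ.2.1⟩
  let g : Fin 2 → (laplacianOp d).domain := fun j => ⟨_, (component_mem_domain φ' j).1⟩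
  refine hasExpDecay_of_integral_expWeight_sq_mul_nonneg (K := (4 * c)⁻¹) (R := R) ha hc
    (by positivity) (Lp.memLp _) (Lp.memLp _)
    (integrable_finsetSum _ fun j _ => integrable_inner_smul_sub_laplacianOp (a ^ 2) (g j))
    (fun ε hε => integral_expWeight_sq_mul_sum_inner_nonneg ha hε g) ?_ hψ
  filter_upwards [hR, ae_sum_inner_smul_sub_laplacianOp_le hc hηc φ] with x hUWx hle hx
  exact hle (hUWx hx)

end Decay

end

end MatrixSchrodinger

theorem theorem2_general {d : ℕ} {μ a η : ℝ} {U W : MatrixSchrodinger.Rd d → ℝ} {E : ℂ}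
    (ha : 0 ≤ a) (hη : a ^ 2 + |E.re| + η < μ)
    (hUW : ∀ᶠ x in Filter.cocompact (MatrixSchrodinger.Rd d) ⊓
      MeasureTheory.ae MeasureTheory.volume, |U x| + |W x| ≤ η)
    (k : ℕ)
    (φ : (MatrixSchrodinger.opPow (MatrixSchrodinger.systemOp μ U W -
      MatrixSchrodinger.scalarOp (MatrixSchrodinger.L2C2 d) E) k).domain)
    (hφ : MatrixSchrodinger.HasExpDecay a (MatrixSchrodinger.opPow
      (MatrixSchrodinger.systemOp μ U W -
        MatrixSchrodinger.scalarOp (MatrixSchrodinger.L2C2 d) E) k φ) MeasureTheory.volume) :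
    MatrixSchrodinger.HasExpDecay a (φ : MatrixSchrodinger.L2C2 d) MeasureTheory.volume := by
  induction k with
  | zero => exact hφ
  | succ k ih =>
    obtain ⟨ψ, hψφ, hψ, hpow⟩ := MatrixSchrodinger.exists_opPow_succ_apply_eq φ
    rw [hpow] at hφ
    rw [← hψφ]
    exact MatrixSchrodinger.hasExpDecay_of_systemOp_sub_scalarOp ha hη hUW ψ (ih ⟨_, hψ⟩ hφ)

theorem theorem2 {d : ℕ} (μ : ℝ) (hμ : 0 < μ) (U W : MatrixSchrodinger.Rd d → ℝ)
    (hU : MatrixSchrodinger.IsLaplacianBoundedWithBoundZero U)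
    (hW : MatrixSchrodinger.IsLaplacianBoundedWithBoundZero W)
    (hU₀ : MatrixSchrodinger.TendsToZeroAtInfinity U)
    (hW₀ : MatrixSchrodinger.TendsToZeroAtInfinity W)
    (E : ℂ) (hE : MatrixSchrodinger.IsEigenvalue (MatrixSchrodinger.systemOp μ U W) E)
    (hE₁ : -μ < E.re) (hE₂ : E.re < μ)
    (k : ℕ)
    (φ : (MatrixSchrodinger.opPow (MatrixSchrodinger.systemOp μ U W -
      MatrixSchrodinger.scalarOp (MatrixSchrodinger.L2C2 d) E) k).domain)
    (hφ : MatrixSchrodinger.opPow (MatrixSchrodinger.systemOp μ U W -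
      MatrixSchrodinger.scalarOp (MatrixSchrodinger.L2C2 d) E) k φ = 0)
    (δ : ℝ) (hδ₀ : 0 < δ) (hδ : δ < (μ - |E.re|) / 2) :
    MeasureTheory.MemLp
      (fun x : MatrixSchrodinger.Rd d =>
        Real.exp (Real.sqrt (μ - |E.re| - 2 * δ) * ‖x‖) • (φ : MatrixSchrodinger.L2C2 d) x)
      2 MeasureTheory.volume := by
  have hrate : 0 ≤ μ - |E.re| - 2 * δ := by linarith
  refine theorem2_general (Real.sqrt_nonneg _) ?_ (hU₀.eventually_abs_add_abs_le hW₀ hδ₀) k φ ?_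
  · linarith [Real.sq_sqrt hrate]
  · exact hφ ▸ MatrixSchrodinger.hasExpDecay_zero _
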